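/- Let $(\Omega,\mathcal F,P)$ be a probability space with a filtration $\mathbb F=(\mathcal F_t)_{t\ge 0}$ satisfying the usual hypotheses: $\mathbb F$ is right continuous and $\mathcal F_0$ contains all $P$-null sets of $\mathcal F$. Let $S^0(\mathbb F)$ be the set of all integrands $$g_0 1_{\{0\}}+\sum_{j=1}^{n-1} g_j 1_{(\tau_j,\tau_{j+1}]},$$ where $n\ge 2$, $0\le\tau_1\le\dots\le\tau_n$ are bounded $\mathbb F$-stopping times, $g_0\ge 0$ is a real number, and each $g_j$ is a non-negative real-valued $\mathcal F_{\tau_j}$-measurable random variable. Let $S(\mathbb F)=S^0(\mathbb F)-S^0(\mathbb F)$ be the set of simple trading strategies. For an adapted process $X$ and $H\in S^0(\mathbb F)$ as displayed, put $(H\cdot X)_\infty=\sum_{j=1}^{n-1} g_j\,(X_{\tau_{j+1}}-X_{\tau_j})$, and extend this to $H\in S(\mathbb F)$ by linearity. We say that $X$ satisfies the no arbitrage property in $S(\mathbb F)$ if, for every $H\in S(\mathbb F)$, $(H\cdot X)_\infty\ge 0$ a.s. implies $(H\cdot X)_\infty=0$ a.s. We say that $X$ satisfies condition $(\star)$ if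 for every bounded stopping time $\tau$, every $A\in\mathcal F_\tau$ with $P(A)>0$, every $\varepsilon>0$ and every real number $T$ with $\tau\le T$ a.s., $$P\Big(A\cap\Big\{\inf_{t\in[\tau,T]}(X_t-X_\tau)>-\varepsilon\Big\}\Big)>0 .$$ **Proposition.** Let $X=(X_t)_{t\ge 0}$ be a non-negative càdlàg $\mathbb F$-semimartingale that admits an equivalent local martingale measure, i.e. a probability measure $Q$ on $\mathcal F$ with the same null sets as $P$ under which $X$ is a local martingale. Then $X$ satisfies the no arbitrage property in $S(\mathbb F)$ if and only if $X$ satisfies condition $(\star)$. -/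

import Mathlib

open MeasureTheory ProbabilityTheory Filter
open scoped NNReal ENNReal Topology Pointwise

namespace SimpleArbitrage

variable {Ω : Type*} {m : MeasurableSpace Ω}

/-- A path `[0, ∞) → ℝ` is càdlàg: right continuous with (finite) left limits. At time `0` the
left limit condition is empty, because the punctured left neighbourhood filter is trivial there. -/
def IsCadlagPath (f : ℝ≥0 → ℝ) : Prop :=
  ∀ t : ℝ≥0, ContinuousWithinAt f (Set.Ici t) t ∧ ∃ l : ℝ, Tendsto f (𝓝[<] t) (𝓝 l)

/-- Almost all paths of the process `X` are càdlàg. -/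
def IsCadlagProcess (X : ℝ≥0 → Ω → ℝ) (P : Measure Ω) : Prop :=
  ∀ᵐ ω ∂P, IsCadlagPath (fun t => X t ω)

/-- The usual hypotheses: the filtration is right continuous and the `σ`-algebra at time `0`
contains all the null sets of the ambient `σ`-algebra. -/
structure UsualHypotheses (𝓕 : Filtration ℝ≥0 m) (P : Measure Ω) : Prop where
  rightContinuous : 𝓕.IsRightContinuous
  null_mem : ∀ N : Set Ω, MeasurableSet[m] N → P N = 0 → MeasurableSet[𝓕 0] N

/-- A local martingale: an adapted càdlàg process `M` for which there are stopping times `τ n`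
increasing a.s. to infinity such that each stopped process `M^(τ n) 1_{τ n > 0}` is a martingale. -/
structure IsLocalMartingale (M : ℝ≥0 → Ω → ℝ) (𝓕 : Filtration ℝ≥0 m) (P : Measure Ω) : Prop where
  adapted : StronglyAdapted 𝓕 M
  cadlag : IsCadlagProcess M P
  locally_martingale : Locally (fun Y => Martingale Y 𝓕 P) 𝓕 M P

/-- A semimartingale: an adapted process which is, up to indistinguishability, the sum of a local
martingale and of an adapted càdlàg process with paths of finite variation on compact intervals. -/
def IsSemimartingale (X : ℝ≥0 → Ω → ℝ) (𝓕 : Filtration ℝ≥0 m) (P : Measure Ω) : Prop :=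
  StronglyAdapted 𝓕 X ∧
  ∃ M A : ℝ≥0 → Ω → ℝ,
    IsLocalMartingale M 𝓕 P ∧
    StronglyAdapted 𝓕 A ∧ IsCadlagProcess A P ∧
    (∀ᵐ ω ∂P, LocallyBoundedVariationOn (fun t => A t ω) Set.univ) ∧
    ∀ᵐ ω ∂P, ∀ t, X t ω = M t ω + A t ω

/-- `X` admits an equivalent local martingale measure: a probability measure `Q` on the same
`σ`-algebra, with the same null sets as `P`, under which `X` is a local martingale. -/
def AdmitsELMM (X : ℝ≥0 → Ω → ℝ) (𝓕 : Filtration ℝ≥0 m) (P : Measure Ω) : Prop :=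
  ∃ Q : Measure Ω, IsProbabilityMeasure Q ∧ Q ≪ P ∧ P ≪ Q ∧ IsLocalMartingale X 𝓕 Q

/-- The data of a simple strategy with short sale restriction
`g₀ 1_{0} + ∑_j g_j 1_{(τ_j, τ_{j+1}]}`: here `k ≥ 1` is the number of intervals,
`τ_0 ≤ … ≤ τ_k` are bounded stopping times, `g₀ ≥ 0` is a real number, and `g_j ≥ 0` is a real
random variable that is measurable for the `σ`-algebra of the past of `τ_j`. -/
structure NoShortData (𝓕 : Filtration ℝ≥0 m) where
  k : ℕ
  one_le_k : 1 ≤ k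
  τ : Fin (k + 1) → Ω → WithTop ℝ≥0
  stopping : ∀ j, IsStoppingTime 𝓕 (τ j)
  bounded : ∀ j, ∃ C : ℝ≥0, ∀ ω, τ j ω ≤ C
  mono : ∀ ω, Monotone (fun j => τ j ω)
  g₀ : ℝ
  g₀_nonneg : 0 ≤ g₀
  g : Fin k → Ω → ℝ
  g_meas : ∀ j : Fin k, Measurable[(stopping j.castSucc).measurableSpace] (g j)
  g_nonneg : ∀ j ω, 0 ≤ g j ω

/-- The integrand `g₀ 1_{0} + ∑_j g_j 1_{(τ_j, τ_{j+1}]}` as a process. -/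
noncomputable def NoShortData.integrand {𝓕 : Filtration ℝ≥0 m} (V : NoShortData 𝓕) :
    ℝ≥0 → Ω → ℝ := fun t ω =>
  Set.indicator {0} (fun _ => V.g₀) t +
    ∑ j : Fin V.k,
      Set.indicator {s : ℝ≥0 | V.τ j.castSucc ω < s ∧ s ≤ V.τ j.succ ω} (fun _ => V.g j ω) t

/-- The terminal gain `∑_j g_j (X_{τ_{j+1}} - X_{τ_j})`. The position held at time `0` alone
contributes nothing. -/
noncomputable def NoShortData.gain {𝓕 : Filtration ℝ≥0 m} (V : NoShortData 𝓕)
    (X : ℝ≥0 → Ω → ℝ) : Ω → ℝ := fun ω =>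
  ∑ j : Fin V.k, V.g j ω * (stoppedValue X (V.τ j.succ) ω - stoppedValue X (V.τ j.castSucc) ω)

/-- Simple trading strategies with short sale restriction, `S⁰(𝔽)`. -/
def noShortStrategies (𝓕 : Filtration ℝ≥0 m) : Set (ℝ≥0 → Ω → ℝ) :=
  Set.range (NoShortData.integrand (𝓕 := 𝓕))

/-- Simple trading strategies, `S(𝔽) = S⁰(𝔽) - S⁰(𝔽)` (all differences of two elements). -/
def simpleStrategies (𝓕 : Filtration ℝ≥0 m) : Set (ℝ≥0 → Ω → ℝ) :=
  noShortStrategies 𝓕 - noShortStrategies 𝓕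

/-- `Z` is the terminal value `(H · X)_∞` of the elementary stochastic integral of `H ∈ S(𝔽)`,
defined by linearity from a representation of `H`. -/
def IsTerminalGain (𝓕 : Filtration ℝ≥0 m) (X H : ℝ≥0 → Ω → ℝ) (Z : Ω → ℝ) : Prop :=
  ∃ V W : NoShortData 𝓕, H = V.integrand - W.integrand ∧ Z = V.gain X - W.gain X

/-- The outcomes `K^s = {(H · X)_∞ | H ∈ S(𝔽)}`. -/
def outcomes (𝓕 : Filtration ℝ≥0 m) (X : ℝ≥0 → Ω → ℝ) : Set (Ω → ℝ) :=
  {Z | ∃ H ∈ simpleStrategies 𝓕, IsTerminalGain 𝓕 X H Z}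

/-- No arbitrage in `S(𝔽)`: an outcome that is a.s. non-negative is a.s. zero. -/
def NoArbitrage (𝓕 : Filtration ℝ≥0 m) (X : ℝ≥0 → Ω → ℝ) (P : Measure Ω) : Prop :=
  ∀ Z ∈ outcomes 𝓕 X, (∀ᵐ ω ∂P, 0 ≤ Z ω) → ∀ᵐ ω ∂P, Z ω = 0

/-- Condition `(⋆)`: for all bounded stopping times `τ`, all `A ∈ 𝓕_τ` with `P(A) > 0`, all `ε > 0`
and all times `T` with `τ ≤ T` a.s., `P(A ∩ {inf_{t ∈ [τ, T]} (X_t - X_τ) > -ε}) > 0`. The infimum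
is taken in the extended reals. -/
def ConditionStar (𝓕 : Filtration ℝ≥0 m) (X : ℝ≥0 → Ω → ℝ) (P : Measure Ω) : Prop :=
  ∀ (τ : Ω → WithTop ℝ≥0) (hτ : IsStoppingTime 𝓕 τ), (∃ C : ℝ≥0, ∀ ω, τ ω ≤ C) →
    ∀ A : Set Ω, MeasurableSet[hτ.measurableSpace] A → 0 < P A →
      ∀ ε : ℝ, 0 < ε → ∀ T : ℝ≥0, (∀ᵐ ω ∂P, τ ω ≤ T) →
        0 < P (A ∩ {ω | ((-ε : ℝ) : EReal) <
          ⨅ t ∈ {t : ℝ≥0 | τ ω ≤ t ∧ t ≤ T}, ((X t ω - stoppedValue X τ ω : ℝ) : EReal)})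

end SimpleArbitrage

namespace SimpleArbitrage

variable {Ω : Type*} {m : MeasurableSpace Ω}

/-! Suppose (⋆) fails for some `τ`, `A`, `ε`, `T`. Then on `A` the price almost surely drops by more
than `ε / 2` before `T`, so selling one share at `τ` on `A` and buying back at the first such drop
is an arbitrage (`NoArbitrage.conditionStar`).

Conversely, assume (⋆). Merging the times of both parts of a strategy turns its gain into a sum over
successive intervals, with positions known at the left endpoints. By induction on the number of
intervals (`ae_sum_eq_zero_of_noIntervalArbitrage`), it is enough to exclude arbitrage over a single
interval from `σ` to `τ`, entered on an event of the past of `σ`, long or short.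

Long positions are excluded by the martingale measure alone: a non-negative local martingale is a
supermartingale by Fatou, so `X_σ ≤ X_τ` forces equality
(`stoppedValue_eq_of_le_of_localMartingale`). For short positions Fatou points the wrong way, and
this is where (⋆) enters. If `X_τ ≤ X_σ`, a path exceeding `X_σ + δ` before `τ` would be certain to
fall by `δ` afterwards, which (⋆) forbids (`ConditionStar.ae_le_add`). The path is thus bounded by
`X_σ + δ` up to `τ`, and dominated convergence replaces Fatou
(`stoppedValue_eq_of_ge_of_localMartingale`). -/

lemma exists_eq_coe_of_le {x : WithTop ℝ≥0} {C : ℝ≥0} (h : x ≤ C) : ∃ t : ℝ≥0, x = t := by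
  lift x to ℝ≥0 using ne_top_of_le_ne_top WithTop.coe_ne_top h
  exact ⟨x, rfl⟩

/-! ### Approximation of stopping times from the right by grid-valued ones -/

/-- The smallest multiple of `1 / (k + 1)` that is strictly larger than `t`. -/
noncomputable def gridSucc (k : ℕ) (t : ℝ≥0) : ℝ≥0 := (⌊(k + 1) * t⌋₊ + 1) / (k + 1)

lemma lt_gridSucc (k : ℕ) (t : ℝ≥0) : t < gridSucc k t := by
  unfold gridSucc
  rw [lt_div_iff₀ (by positivity), mul_comm]
  exact Nat.lt_floor_add_one _

lemma gridSucc_le (k : ℕ) (t : ℝ≥0) : gridSucc k t ≤ t + 1 / (k + 1) := by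
  unfold gridSucc
  rw [div_le_iff₀ (by positivity), add_mul t, div_mul_cancel₀ _ (by positivity), mul_comm t]
  gcongr
  exact Nat.floor_le (by positivity)

lemma tendsto_gridSucc (t : ℝ≥0) : Tendsto (fun k ↦ gridSucc k t) atTop (𝓝[≥] t) := by
  refine tendsto_nhdsWithin_iff.2 ⟨?_, .of_forall fun k ↦ (lt_gridSucc k t).le⟩
  refine tendsto_of_tendsto_of_tendsto_of_le_of_le tendsto_const_nhds (h := fun k : ℕ ↦
    t + 1 / ((k : ℝ≥0) + 1)) ?_ (fun k ↦ (lt_gridSucc k t).le) (fun k ↦ gridSucc_le k t)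
  simpa using tendsto_const_nhds.add (tendsto_one_div_add_atTop_nhds_zero_nat (𝕜 := ℝ≥0))

lemma gridSucc_le_iff (k : ℕ) (t i : ℝ≥0) :
    gridSucc k t ≤ i ↔ t < ⌊(k + 1) * i⌋₊ / ((k : ℝ≥0) + 1) := by
  unfold gridSucc
  rw [div_le_iff₀ (by positivity), lt_div_iff₀ (by positivity), mul_comm i, mul_comm t]
  have h1 : ((⌊((k : ℝ≥0) + 1) * t⌋₊ : ℝ≥0) + 1 ≤ (k + 1) * i) ↔
      ⌊((k : ℝ≥0) + 1) * t⌋₊ + 1 ≤ ⌊((k : ℝ≥0) + 1) * i⌋₊ := by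
    rw [Nat.le_floor_iff (by positivity)]
    push_cast
    rfl
  rw [h1, Nat.succ_le_iff, Nat.floor_lt (by positivity)]

/-- Because the grid point lies strictly to the right, reaching it by time `i` means that `τ` is
strictly before the last grid point not exceeding `i`, which is known at time `i`. -/
lemma IsStoppingTime.gridSucc {𝓕 : Filtration ℝ≥0 m} {τ : Ω → WithTop ℝ≥0}
    (hτ : IsStoppingTime 𝓕 τ) (k : ℕ) : IsStoppingTime 𝓕 (fun ω ↦ (τ ω).map (gridSucc k)) := by
  intro i
  have : {ω | (τ ω).map (SimpleArbitrage.gridSucc k) ≤ (i : WithTop ℝ≥0)} =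
      {ω | τ ω < ((⌊(k + 1) * i⌋₊ / ((k : ℝ≥0) + 1) : ℝ≥0) : WithTop ℝ≥0)} := by
    ext ω
    cases h : τ ω with
    | top =>
      simp only [Set.mem_ofPred_eq, h, WithTop.map_top]
      exact iff_of_false (WithTop.not_top_le_coe _) not_top_lt
    | coe t =>
      simp only [Set.mem_ofPred_eq, h, WithTop.map_coe, WithTop.coe_le_coe, WithTop.coe_lt_coe]
      exact gridSucc_le_iff k t i
  rw [this]
  refine hτ.measurableSet_lt_le ?_
  rw [div_le_iff₀ (by positivity), mul_comm i]
  exact Nat.floor_le (by positivity)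

/-! ### Progressive measurability -/

lemma measurable_comp_floor {ms : MeasurableSpace Ω} {i : ℝ≥0} (k : ℕ) (u : ℕ → Ω → ℝ)
    (hu : ∀ n, Measurable (u n)) :
    Measurable fun p : Set.Iic i × Ω ↦ u ⌊((k : ℝ≥0) + 1) * p.1⌋₊ p.2 := by
  have h1 : Measurable (fun q : ℕ × Ω ↦ u q.1 q.2) :=
    measurable_from_prod_countable_right fun n ↦ hu n
  have h2 : Measurable (fun p : Set.Iic i × Ω ↦ (⌊((k : ℝ≥0) + 1) * p.1⌋₊, p.2)) := by
    fun_prop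
  exact h1.comp h2

/-- An adapted process with right continuous paths is progressive. -/
lemma isStronglyProgressive_of_rightContinuous {𝓕 : Filtration ℝ≥0 m} {X : ℝ≥0 → Ω → ℝ}
    (hX : StronglyAdapted 𝓕 X)
    (hc : ∀ ω t, ContinuousWithinAt (fun s ↦ X s ω) (Set.Ici t) t) :
    IsStronglyProgressive 𝓕 X := by
  intro i
  -- Truncating the grid point at `i` keeps every sampled value measurable at time `i`; the
  -- truncated points still tend to `s ≤ i` from the right.
  refine stronglyMeasurable_of_tendsto (m := Subtype.instMeasurableSpace.prod (𝓕 i)) atTop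
    (f := fun (k : ℕ) (p : Set.Iic i × Ω) ↦ X (min (gridSucc k p.1) i) p.2) ?_ ?_
  · intro k
    exact (measurable_comp_floor (ms := 𝓕 i) k
      (fun n : ℕ ↦ X (min ((n + 1) / (k + 1)) i)) fun n ↦
        ((hX _).mono (𝓕.mono (min_le_right _ _))).measurable).stronglyMeasurable
  · rw [tendsto_pi_nhds]
    rintro ⟨⟨s, hs⟩, ω⟩
    refine (hc ω s).tendsto.comp ?_
    have h := tendsto_nhdsWithin_iff.1 (tendsto_gridSucc s)
    refine tendsto_nhdsWithin_iff.2 ⟨?_, ?_⟩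
    · have := h.1.min (tendsto_const_nhds (x := i))
      rwa [min_eq_left (Set.mem_Iic.1 hs)] at this
    · exact .of_forall fun k ↦ le_min (lt_gridSucc k s).le hs

/-! ### Optional sampling -/

/-- At the grid approximations, which take countably many values, the stopped martingale is a
conditional expectation of `M (C + 1)`; the extra `1` absorbs the overshoot of the grid. Such a
family is uniformly integrable, so the almost sure limit given by right continuity is also an `L¹`
limit. -/
lemma integrable_setIntegral_stoppedValue {Q : Measure Ω} [IsFiniteMeasure Q]
    {𝓕 : Filtration ℝ≥0 m} {M : ℝ≥0 → Ω → ℝ} (hM : Martingale M 𝓕 Q)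
    (hc : ∀ᵐ ω ∂Q, ∀ t, ContinuousWithinAt (fun s ↦ M s ω) (Set.Ici t) t)
    {τ : Ω → WithTop ℝ≥0} (hτ : IsStoppingTime 𝓕 τ) {C : ℝ≥0} (hC : ∀ ω, τ ω ≤ C) :
    Integrable (stoppedValue M τ) Q ∧ ∀ A, MeasurableSet[hτ.measurableSpace] A →
      ∫ ω in A, stoppedValue M τ ω ∂Q = ∫ ω in A, M (C + 1) ω ∂Q := by
  set T : ℕ → Ω → WithTop ℝ≥0 := fun k ω ↦ (τ ω).map (gridSucc k)
  have hT : ∀ k, IsStoppingTime 𝓕 (T k) := fun k ↦ IsStoppingTime.gridSucc hτ k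
  have hTC : ∀ k ω, T k ω ≤ ((C + 1 : ℝ≥0) : WithTop ℝ≥0) := by
    intro k ω
    have := hC ω
    obtain ⟨t, h⟩ := exists_eq_coe_of_le (hC ω)
    simp only [T, h, WithTop.map_coe, WithTop.coe_le_coe] at this ⊢
    refine (gridSucc_le k t).trans (add_le_add this ?_)
    rw [div_le_one (by positivity)]
    simp
  have hle : ∀ k, τ ≤ T k := by
    intro k ω
    obtain ⟨t, h⟩ := exists_eq_coe_of_le (hC ω)
    simpa only [T, h, WithTop.map_coe, WithTop.coe_le_coe] using (lt_gridSucc k t).le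
  have hcount : ∀ k, (Set.range (T k)).Countable := by
    intro k
    refine (Set.countable_range (fun n : ℕ ↦
      (((n + 1) / (k + 1) : ℝ≥0) : WithTop ℝ≥0))).mono ?_
    rintro _ ⟨ω, rfl⟩
    obtain ⟨t, h⟩ := exists_eq_coe_of_le (hC ω)
    exact ⟨⌊(k + 1) * t⌋₊, by simp only [T, h, WithTop.map_coe]; rfl⟩
  have hcond : ∀ k, stoppedValue M (T k) =ᵐ[Q] Q[M (C + 1) | (hT k).measurableSpace] := fun k ↦
    hM.stoppedValue_ae_eq_condExp_of_le_const_of_countable_range (hT k) (hTC k) (hcount k)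
  have hUI : UniformIntegrable (fun k ↦ stoppedValue M (T k)) 1 Q :=
    ((hM.integrable (C + 1)).uniformIntegrable_condExp
      (fun k ↦ (hT k).measurableSpace_le)).ae_eq fun k ↦ (hcond k).symm
  have hlim : ∀ᵐ ω ∂Q, Tendsto (fun k ↦ stoppedValue M (T k) ω) atTop
      (𝓝 (stoppedValue M τ ω)) := by
    filter_upwards [hc] with ω hω
    obtain ⟨t, h⟩ := exists_eq_coe_of_le (hC ω)
    simp only [stoppedValue, T, h, WithTop.map_coe]
    exact (hω t).tendsto.comp (tendsto_gridSucc t)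
  have hL : MemLp (stoppedValue M τ) 1 Q := by
    obtain ⟨R, hR⟩ := hUI.2.2
    refine ⟨aestronglyMeasurable_of_tendsto_ae atTop (fun k ↦ hUI.1 k) hlim, ?_⟩
    refine (Lp.eLpNorm_lim_le_liminf_eLpNorm (fun k ↦ hUI.1 k) _ hlim).trans_lt ?_
    refine lt_of_le_of_lt (b := (R : ℝ≥0∞)) ?_ ENNReal.coe_lt_top
    refine (liminf_le_liminf (.of_forall hR)).trans ?_
    simp
  have hconv := tendsto_Lp_finite_of_tendsto_ae le_rfl ENNReal.one_ne_top (fun k ↦ hUI.1 k) hL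
    hUI.2.1 hlim
  refine ⟨memLp_one_iff_integrable.1 hL, fun A hA ↦ ?_⟩
  have h1 : Tendsto (fun k ↦ ∫ ω in A, stoppedValue M (T k) ω ∂Q) atTop
      (𝓝 (∫ ω in A, stoppedValue M τ ω ∂Q)) := by
    refine tendsto_setIntegral_of_L1' _ hL.1
      (.of_forall fun k ↦ ?_) hconv A
    exact (integrable_condExp).congr (hcond k).symm
  refine tendsto_nhds_unique h1 (tendsto_const_nhds.congr fun k ↦ ?_)
  have hAk : MeasurableSet[(hT k).measurableSpace] A := hτ.measurableSpace_mono (hT k) (hle k) A hA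
  rw [← setIntegral_condExp (hT k).measurableSpace_le (hM.integrable _) hAk]
  refine integral_congr_ae (ae_restrict_of_ae ?_)
  exact (hcond k).symm

/-- Optional sampling for right continuous martingales and bounded stopping times. -/
lemma setIntegral_stoppedValue_eq {Q : Measure Ω} [IsFiniteMeasure Q]
    {𝓕 : Filtration ℝ≥0 m} {M : ℝ≥0 → Ω → ℝ} (hM : Martingale M 𝓕 Q)
    (hc : ∀ᵐ ω ∂Q, ∀ t, ContinuousWithinAt (fun s ↦ M s ω) (Set.Ici t) t)
    {σ τ : Ω → WithTop ℝ≥0} (hσ : IsStoppingTime 𝓕 σ) (hτ : IsStoppingTime 𝓕 τ) (hστ : σ ≤ τ)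
    {C : ℝ≥0} (hC : ∀ ω, τ ω ≤ C) {A : Set Ω} (hA : MeasurableSet[hσ.measurableSpace] A) :
    ∫ ω in A, stoppedValue M σ ω ∂Q = ∫ ω in A, stoppedValue M τ ω ∂Q := by
  rw [(integrable_setIntegral_stoppedValue hM hc hσ fun ω ↦ (hστ ω).trans (hC ω)).2 A hA,
    (integrable_setIntegral_stoppedValue hM hc hτ hC).2 A (hσ.measurableSpace_mono hτ hστ A hA)]

/-! ### Entry times into open half-lines -/

/-- The first time after `a` at which the path `f` enters `(c, ∞)`, truncated at `C`. -/
noncomputable def entryTime (f : ℝ≥0 → ℝ) (a : ℝ≥0) (c : ℝ) (C : ℝ≥0) : ℝ≥0 :=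
  sInf {s | a ≤ s ∧ (c < f s ∨ C ≤ s)}

section entryTime

variable {f : ℝ≥0 → ℝ} {a C : ℝ≥0} {c : ℝ}

lemma entryTime_le (ha : a ≤ C) : entryTime f a c C ≤ C :=
  csInf_le (OrderBot.bddBelow _) ⟨ha, Or.inr le_rfl⟩

lemma le_entryTime (ha : a ≤ C) : a ≤ entryTime f a c C :=
  le_csInf ⟨C, ha, Or.inr le_rfl⟩ fun _ h ↦ h.1

lemma entryTime_lt_iff (ha : a ≤ C) {i : ℝ≥0} :
    entryTime f a c C < i ↔ ∃ s, a ≤ s ∧ (c < f s ∨ C ≤ s) ∧ s < i := by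
  unfold entryTime
  refine (csInf_lt_iff (OrderBot.bddBelow _)
    ⟨C, (⟨ha, Or.inr le_rfl⟩ : a ≤ C ∧ (c < f C ∨ C ≤ C))⟩).trans ?_
  simp [and_assoc]

lemma le_of_lt_entryTime {t : ℝ≥0} (hat : a ≤ t) (ht : t < entryTime f a c C) : f t ≤ c := by
  by_contra! h
  exact absurd (csInf_le (OrderBot.bddBelow _) (show t ∈ {s | a ≤ s ∧ (c < f s ∨ C ≤ s)} from
    ⟨hat, Or.inl h⟩)) (not_le.2 ht)

/-- The set entered is open, so the infimum need not be attained; right continuity still gives the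
weak inequality, provided that entry occurs before the truncation. -/
lemma le_apply_entryTime (hf : ∀ t, ContinuousWithinAt f (Set.Ici t) t) (ha : a ≤ C)
    (h : entryTime f a c C < C) : c ≤ f (entryTime f a c C) := by
  by_contra! hlt
  set ν := entryTime f a c C
  have h1 : ∀ᶠ s in 𝓝[≥] ν, f s < c := (hf ν).tendsto.eventually (gt_mem_nhds hlt)
  obtain ⟨u, hu, hs⟩ := (mem_nhdsGE_iff_exists_Ico_subset' h).1 h1
  have hu' : ν < min u C := lt_min hu h
  obtain ⟨s, has, hsc, hsu⟩ := (entryTime_lt_iff ha).1 hu'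
  have hνs : ν ≤ s := csInf_le (OrderBot.bddBelow _) ⟨has, hsc⟩
  have := hs ⟨hνs, hsu.trans_le (min_le_left _ _)⟩
  rcases hsc with hsc | hsc
  · exact absurd hsc (not_lt.2 (le_of_lt this))
  · exact absurd (hsu.trans_le (min_le_right _ _)) (not_lt.2 hsc)

end entryTime

lemma exists_mem_dense_of_lt {f : ℝ≥0 → ℝ} (hf : ∀ t, ContinuousWithinAt f (Set.Ici t) t)
    {D : Set ℝ≥0} (hD : Dense D) {s i : ℝ≥0} {c : ℝ} (hsi : s < i) (hs : c < f s) :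
    ∃ q ∈ D, s ≤ q ∧ q < i ∧ c < f q := by
  have h1 : ∀ᶠ u in 𝓝[≥] s, c < f u := (hf s).tendsto.eventually (lt_mem_nhds hs)
  obtain ⟨u, hu, hsub⟩ := (mem_nhdsGE_iff_exists_Ico_subset' hsi).1 h1
  obtain ⟨q, hqD, hq⟩ := hD.exists_between (lt_min hu hsi : s < min u i)
  exact ⟨q, hqD, hq.1.le, hq.2.trans_le (min_le_right _ _),
    hsub ⟨hq.1.le, hq.2.trans_le (min_le_left _ _)⟩⟩

/-- The first time after a bounded stopping time `τ` at which `X` exceeds `X_τ + δ` is a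
stopping time. -/
lemma isStoppingTime_entryTime {𝓕 : Filtration ℝ≥0 m} (h𝓕 : 𝓕.IsRightContinuous)
    {X : ℝ≥0 → Ω → ℝ} (hX : StronglyAdapted 𝓕 X)
    (hc : ∀ ω t, ContinuousWithinAt (fun s ↦ X s ω) (Set.Ici t) t)
    {τ : Ω → WithTop ℝ≥0} (hτ : IsStoppingTime 𝓕 τ) {C : ℝ≥0} (hC : ∀ ω, τ ω ≤ C) (δ : ℝ) :
    IsStoppingTime 𝓕 (fun ω ↦ ((entryTime (fun s ↦ X s ω) (τ ω).untopA
      (stoppedValue X τ ω + δ) C : ℝ≥0) : WithTop ℝ≥0)) := by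
  have hprog := isStronglyProgressive_of_rightContinuous hX hc
  have hC' : ∀ ω, (τ ω).untopA ≤ C := fun ω ↦ WithTop.untopA_le (hC ω)
  have hcoe : ∀ ω, τ ω = ((τ ω).untopA : WithTop ℝ≥0) := fun ω ↦
    by obtain ⟨t, h⟩ := exists_eq_coe_of_le (hC ω); rw [h]; rfl
  -- Entry into an open set is seen strictly before `i` through countably many times `q < i`, but
  -- not necessarily by time `i` itself; right continuity of the filtration bridges the gap.
  refine isStoppingTime_of_measurableSet_lt_of_isRightContinuous fun i ↦ ?_
  rcases lt_or_ge C i with hCi | hCi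
  · convert @MeasurableSet.univ _ (𝓕 i)
    refine Set.eq_univ_of_forall fun ω ↦ ?_
    exact WithTop.coe_lt_coe.2 ((entryTime_le (hC' ω)).trans_lt hCi)
  obtain ⟨D, hDc, hD⟩ := TopologicalSpace.exists_countable_dense ℝ≥0
  -- Stopping at `min τ q` makes the reference level measurable at time `q`, without changing it on
  -- `τ ≤ q`.
  have : {ω | ((entryTime (fun s ↦ X s ω) (τ ω).untopA
      (stoppedValue X τ ω + δ) C : ℝ≥0) : WithTop ℝ≥0) < i} =
      ⋃ q ∈ D ∩ Set.Iio i, ({ω | τ ω ≤ q} ∩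
        {ω | stoppedValue X (fun ω ↦ min (τ ω) q) ω + δ < X q ω}) := by
    ext ω
    simp only [Set.mem_ofPred_eq, WithTop.coe_lt_coe, entryTime_lt_iff (hC' ω), Set.mem_iUnion,
      Set.mem_inter_iff, Set.mem_Iio, exists_prop]
    constructor
    · rintro ⟨s, has, hs | hs, hsi⟩
      · obtain ⟨q, hqD, hsq, hqi, hq⟩ := exists_mem_dense_of_lt (hc ω) hD hsi hs
        have hτq : τ ω ≤ q := by rw [hcoe ω]; exact_mod_cast has.trans hsq
        refine ⟨q, ⟨hqD, hqi⟩, hτq, ?_⟩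
        simpa only [stoppedValue, min_eq_left hτq] using hq
      · exact absurd (hs.trans_lt hsi) (not_lt.2 hCi)
    · rintro ⟨q, ⟨hqD, hqi⟩, hτq, hq⟩
      simp only [stoppedValue, min_eq_left hτq] at hq
      exact ⟨q, WithTop.untopA_le hτq, Or.inl hq, hqi⟩
  rw [this]
  refine MeasurableSet.biUnion (hDc.mono Set.inter_subset_left) fun q hq ↦ ?_
  refine 𝓕.mono (le_of_lt hq.2) _ (MeasurableSet.inter (hτ q) ?_)
  exact measurableSet_lt (((stronglyMeasurable_stoppedValue_of_le hprog (hτ.min_const q)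
    fun ω ↦ min_le_right _ _).measurable).add_const δ) (hX q).measurable

lemma continuousWithinAt_comp_min {f : ℝ≥0 → ℝ} (hf : ∀ t, ContinuousWithinAt f (Set.Ici t) t)
    (r : WithTop ℝ≥0) (t : ℝ≥0) :
    ContinuousWithinAt (fun s : ℝ≥0 ↦ f (min (s : WithTop ℝ≥0) r).untopA) (Set.Ici t) t := by
  cases r with
  | top =>
    have : (fun s : ℝ≥0 ↦ f (min (s : WithTop ℝ≥0) ⊤).untopA) = f := by
      ext s; rw [min_eq_left le_top]; rfl
    rw [this]
    exact hf t
  | coe r =>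
    have : (fun s : ℝ≥0 ↦ f (min (s : WithTop ℝ≥0) r).untopA) = f ∘ fun s ↦ min s r := by
      ext s; rw [← WithTop.coe_min]; rfl
    rw [this]
    refine ContinuousWithinAt.comp (t := Set.Ici (min t r)) (hf _) ?_ ?_
    · exact (continuous_id.min continuous_const).continuousWithinAt
    · exact fun s hs ↦ min_le_min_right r hs

lemma exists_untopA_min_mem {s t : WithTop ℝ≥0} {C : ℝ≥0} (hst : s ≤ t) (ht : t ≤ C)
    {r : WithTop ℝ≥0} (hr : s ≤ r) :
    s ≤ ((min t r).untopA : WithTop ℝ≥0) ∧ ((min t r).untopA : WithTop ℝ≥0) ≤ t := by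
  obtain ⟨u, hu⟩ := exists_eq_coe_of_le ((min_le_left t r).trans ht)
  have : ((min t r).untopA : WithTop ℝ≥0) = min t r := by rw [hu]; rfl
  rw [this]
  exact ⟨le_min hst hr, min_le_left _ _⟩

/-! ### Non-negative local martingales between two stopping times -/

section Localization

variable {Q : Measure Ω} {𝓕 : Filtration ℝ≥0 m} {X : ℝ≥0 → Ω → ℝ}
  {ρ : ℕ → Ω → WithTop ℝ≥0}

/-- Optional sampling along a localizing sequence, on an event of the past of `σ` on which
`σ` comes before the `k`-th localizing time. -/
lemma exists_localized_stoppedValue [IsProbabilityMeasure Q]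
    (hc : ∀ ω t, ContinuousWithinAt (fun s ↦ X s ω) (Set.Ici t) t) (hX0 : ∀ ω t, 0 ≤ X t ω)
    (hρ : IsLocalizingSequence 𝓕 ρ Q)
    (hM : ∀ n, Martingale
      (stoppedProcess (fun i ↦ {ω | ⊥ < ρ n ω}.indicator (X i)) (ρ n)) 𝓕 Q)
    {σ τ : Ω → WithTop ℝ≥0} (hσ : IsStoppingTime 𝓕 σ) (hτ : IsStoppingTime 𝓕 τ) (hστ : σ ≤ τ)
    {C : ℝ≥0} (hC : ∀ ω, τ ω ≤ C) {A : Set Ω} (hA : MeasurableSet[hσ.measurableSpace] A) {k : ℕ}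
    (hA0 : ∀ ω ∈ A, ⊥ < ρ k ω) (hAσ : ∀ ω ∈ A, σ ω ≤ ρ k ω) :
    ∃ Y : ℕ → Ω → ℝ, (∀ n, AEMeasurable (Y n) Q) ∧ (∀ n ω, 0 ≤ Y n ω) ∧
      (∀ᵐ ω ∂Q, ω ∈ A → Tendsto (fun n ↦ Y n ω) atTop (𝓝 (stoppedValue X τ ω))) ∧
      (∀ᵐ ω ∂Q, ω ∈ A → ∀ n ≥ k, ∃ t : ℝ≥0, σ ω ≤ t ∧ t ≤ τ ω ∧ Y n ω = X t ω) ∧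
      ∀ n ≥ k, ∫⁻ ω in A, ENNReal.ofReal (Y n ω) ∂Q =
        ∫⁻ ω in A, ENNReal.ofReal (stoppedValue X σ ω) ∂Q := by
  set M : ℕ → ℝ≥0 → Ω → ℝ := fun n ↦
    stoppedProcess (fun i ↦ {ω | ⊥ < ρ n ω}.indicator (X i)) (ρ n)
  have hAm : MeasurableSet A := hσ.measurableSpace_le A hA
  have hMc : ∀ n, ∀ᵐ ω ∂Q, ∀ t, ContinuousWithinAt (fun s ↦ M n s ω) (Set.Ici t) t := by
    refine fun n ↦ .of_forall fun ω t ↦ ?_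
    refine continuousWithinAt_comp_min (f := fun s ↦ {ω | ⊥ < ρ n ω}.indicator (X s) ω)
      (fun t ↦ ?_) (ρ n ω) t
    by_cases h : ω ∈ {ω | ⊥ < ρ n ω}
    · simpa only [Set.indicator_of_mem h] using hc ω t
    · simpa only [Set.indicator_of_notMem h] using continuousWithinAt_const
  have hval : ∀ n ω, ⊥ < ρ n ω → ∀ θ : Ω → WithTop ℝ≥0, θ ω ≤ C →
      stoppedValue (M n) θ ω = X (min (θ ω) (ρ n ω)).untopA ω := by
    intro n ω hn θ hθ
    rw [stoppedValue_stoppedProcess_apply (ne_top_of_le_ne_top WithTop.coe_ne_top hθ)]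
    exact Set.indicator_of_mem (s := {ω | ⊥ < ρ n ω}) hn _
  have hmono : ∀ᵐ ω ∂Q, ω ∈ A → ∀ n ≥ k, ⊥ < ρ n ω ∧ σ ω ≤ ρ n ω := by
    filter_upwards [hρ.mono] with ω hω hωA n hn
    exact ⟨(hA0 ω hωA).trans_le (hω hn), (hAσ ω hωA).trans (hω hn)⟩
  have hY0 : ∀ n (θ : Ω → WithTop ℝ≥0) ω, 0 ≤ stoppedValue (M n) θ ω := fun n θ ω ↦
    Set.indicator_nonneg (fun ω _ ↦ hX0 ω _) ω
  have hσC : ∀ ω, σ ω ≤ C := fun ω ↦ (hστ ω).trans (hC ω)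
  have hint := fun n ↦ (integrable_setIntegral_stoppedValue (hM n) (hMc n) hτ hC).1
  have hintσ := fun n ↦ (integrable_setIntegral_stoppedValue (hM n) (hMc n) hσ hσC).1
  refine ⟨fun n ↦ stoppedValue (M n) τ, fun n ↦ (hint n).aemeasurable, fun n ω ↦ hY0 n τ ω,
    ?_, ?_, ?_⟩
  · filter_upwards [hρ.tendsto_top, hmono] with ω hlim hω hωA
    refine tendsto_const_nhds.congr' ?_
    filter_upwards [hlim.eventually (lt_mem_nhds (WithTop.coe_lt_top C)), eventually_ge_atTop k]
      with n hn hkn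
    rw [hval n ω (hω hωA n hkn).1 τ (hC ω), min_eq_left ((hC ω).trans hn.le)]
    rfl
  · filter_upwards [hmono] with ω hω hωA n hn
    obtain ⟨h0, h1⟩ := hω hωA n hn
    exact ⟨_, (exists_untopA_min_mem (hστ ω) (hC ω) h1).1,
      (exists_untopA_min_mem (hστ ω) (hC ω) h1).2, hval n ω h0 τ (hC ω)⟩
  · intro n hn
    have h1 : ∫⁻ ω in A, ENNReal.ofReal (stoppedValue X σ ω) ∂Q =
        ∫⁻ ω in A, ENNReal.ofReal (stoppedValue (M n) σ ω) ∂Q := by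
      refine setLIntegral_congr_fun_ae hAm ?_
      filter_upwards [hmono] with ω hω hωA
      rw [hval n ω (hω hωA n hn).1 σ (hσC ω), min_eq_left (hω hωA n hn).2]
      rfl
    rw [h1, ← ofReal_integral_eq_lintegral_ofReal (hint n).integrableOn
        (.of_forall fun ω ↦ hY0 n τ ω),
      ← ofReal_integral_eq_lintegral_ofReal (hintσ n).integrableOn
        (.of_forall fun ω ↦ hY0 n σ ω), setIntegral_stoppedValue_eq (hM n) (hMc n) hσ hτ hστ hC hA]

variable (hX : StronglyAdapted 𝓕 X)
    (hc : ∀ ω t, ContinuousWithinAt (fun s ↦ X s ω) (Set.Ici t) t) (hX0 : ∀ ω t, 0 ≤ X t ω)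
    (hρ : IsLocalizingSequence 𝓕 ρ Q)
    (hM : ∀ n, Martingale
      (stoppedProcess (fun i ↦ {ω | ⊥ < ρ n ω}.indicator (X i)) (ρ n)) 𝓕 Q)
    {σ τ : Ω → WithTop ℝ≥0} (hσ : IsStoppingTime 𝓕 σ) (hτ : IsStoppingTime 𝓕 τ) (hστ : σ ≤ τ)
    {C : ℝ≥0} (hC : ∀ ω, τ ω ≤ C) {A : Set Ω} (hA : MeasurableSet[hσ.measurableSpace] A)

include hX hc hρ hσ hA in
/-- To prove a property almost everywhere on an event `A` of the past of a bounded stopping time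
`σ`, one may assume that `X_σ` is bounded on `A` and that `σ` comes before some localizing time. -/
lemma ae_of_forall_localized {C : ℝ≥0} (hC : ∀ ω, σ ω ≤ C) {p : Ω → Prop}
    (h : ∀ B : Set Ω, MeasurableSet[hσ.measurableSpace] B → B ⊆ A → ∀ k : ℕ,
      (∀ ω ∈ B, ⊥ < ρ k ω) → (∀ ω ∈ B, σ ω ≤ ρ k ω) → (∀ ω ∈ B, stoppedValue X σ ω ≤ k) →
      ∀ᵐ ω ∂Q, ω ∈ B → p ω) :
    ∀ᵐ ω ∂Q, ω ∈ A → p ω := by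
  have hk : ∀ k : ℕ, ∀ᵐ ω ∂Q,
      ω ∈ A ∩ ({ω | ⊥ < ρ k ω} ∩ ({ω | σ ω ≤ ρ k ω} ∩ {ω | stoppedValue X σ ω ≤ k})) → p ω := by
    intro k
    refine h _ ?_ Set.inter_subset_left k (fun ω hω ↦ hω.2.1) (fun ω hω ↦ hω.2.2.1)
      (fun ω hω ↦ hω.2.2.2)
    refine hA.inter (MeasurableSet.inter ?_ (MeasurableSet.inter ?_ ?_))
    · have h0 : MeasurableSet[𝓕 0] {ω | ((0 : ℝ≥0) : WithTop ℝ≥0) < ρ k ω} :=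
        (hρ.isStoppingTime k).measurableSet_gt 0
      exact hσ.le_measurableSpace_of_const_le (i := 0) (fun ω ↦ bot_le) _ h0
    · exact hσ.measurableSet_le_stopping_time (hρ.isStoppingTime k)
    · exact measurableSet_le (measurable_stoppedValue
        (isStronglyProgressive_of_rightContinuous hX hc) hσ) measurable_const
  filter_upwards [ae_all_iff.2 hk, hρ.tendsto_top] with ω hω hlim hωA
  obtain ⟨k, hk1, hk2⟩ := ((hlim.eventually (lt_mem_nhds (WithTop.coe_lt_top C))).and
    (tendsto_natCast_atTop_atTop.eventually_ge_atTop (stoppedValue X σ ω))).exists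
  exact hω k ⟨hωA, bot_le.trans_lt hk1, (hC ω).trans hk1.le, hk2⟩

include hX hc hX0 hρ hM hσ hτ hστ hC hA in
-- Fatou along the localizing sequence bounds the integral of `X_τ` by that of `X_σ`, which is
-- finite after localization. Two ordered functions with integrals ordered the other way agree
-- almost everywhere.
lemma stoppedValue_eq_of_le_of_localMartingale [IsProbabilityMeasure Q]
    (hle : ∀ᵐ ω ∂Q, ω ∈ A → stoppedValue X σ ω ≤ stoppedValue X τ ω) :
    ∀ᵐ ω ∂Q, ω ∈ A → stoppedValue X τ ω = stoppedValue X σ ω := by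
  have hprog := isStronglyProgressive_of_rightContinuous hX hc
  have hmτ : Measurable (stoppedValue X τ) :=
    (measurable_stoppedValue hprog hτ).mono hτ.measurableSpace_le le_rfl
  refine ae_of_forall_localized hX hc hρ hσ hA (fun ω ↦ (hστ ω).trans (hC ω)) ?_
  intro B hB hBA k hB0 hBσ hBk
  have hBm : MeasurableSet B := hσ.measurableSpace_le B hB
  obtain ⟨Y, hYm, hY0, hYlim, -, hYint⟩ :=
    exists_localized_stoppedValue hc hX0 hρ hM hσ hτ hστ hC hB hB0 hBσ
  have hfin : ∫⁻ ω in B, ENNReal.ofReal (stoppedValue X σ ω) ∂Q ≠ ⊤ := by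
    refine ne_top_of_le_ne_top (b := ∫⁻ ω in B, ENNReal.ofReal k ∂Q) (by
      simpa using ENNReal.mul_ne_top (by simp) (measure_ne_top _ _)) ?_
    exact setLIntegral_mono measurable_const fun ω hω ↦ ENNReal.ofReal_le_ofReal (hBk ω hω)
  have hfatou : ∫⁻ ω in B, ENNReal.ofReal (stoppedValue X τ ω) ∂Q ≤
      ∫⁻ ω in B, ENNReal.ofReal (stoppedValue X σ ω) ∂Q := by
    calc ∫⁻ ω in B, ENNReal.ofReal (stoppedValue X τ ω) ∂Q
        = ∫⁻ ω in B, liminf (fun n ↦ ENNReal.ofReal (Y n ω)) atTop ∂Q := by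
          refine setLIntegral_congr_fun_ae hBm ?_
          filter_upwards [hYlim] with ω hω hωB
          exact ((ENNReal.continuous_ofReal.tendsto _).comp (hω hωB)).liminf_eq.symm
      _ ≤ liminf (fun n ↦ ∫⁻ ω in B, ENNReal.ofReal (Y n ω) ∂Q) atTop :=
          lintegral_liminf_le' fun n ↦ (hYm n).ennreal_ofReal.restrict
      _ = ∫⁻ ω in B, ENNReal.ofReal (stoppedValue X σ ω) ∂Q := by
          refine Tendsto.liminf_eq (tendsto_const_nhds.congr' ?_)
          filter_upwards [eventually_ge_atTop k] with n hn using (hYint n hn).symm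
  have heq := ae_eq_of_ae_le_of_lintegral_le (μ := Q.restrict B)
    (f := fun ω ↦ ENNReal.ofReal (stoppedValue X σ ω))
    (g := fun ω ↦ ENNReal.ofReal (stoppedValue X τ ω))
    (by
      rw [EventuallyLE, ae_restrict_iff' hBm]
      filter_upwards [hle] with ω hω hωB using ENNReal.ofReal_le_ofReal (hω (hBA hωB)))
    hfin hmτ.ennreal_ofReal.aemeasurable hfatou
  rw [EventuallyEq, ae_restrict_iff' hBm] at heq
  filter_upwards [heq] with ω hω hωB
  exact ((ENNReal.ofReal_eq_ofReal_iff (hX0 _ _) (hX0 _ _)).1 (hω hωB)).symm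

include hX hc hX0 hρ hM hσ hτ hστ hC hA in
-- The pathwise bound dominates the localized values by the constant `k + δ`, so the integrals of
-- `X_σ` and `X_τ` coincide and no mass is lost in the limit.
lemma stoppedValue_eq_of_ge_of_localMartingale [IsProbabilityMeasure Q]
    (hle : ∀ᵐ ω ∂Q, ω ∈ A → stoppedValue X τ ω ≤ stoppedValue X σ ω)
    {δ : ℝ} (hδ : ∀ᵐ ω ∂Q, ω ∈ A → ∀ t : ℝ≥0, σ ω ≤ t → t ≤ τ ω → X t ω ≤ stoppedValue X σ ω + δ) :
    ∀ᵐ ω ∂Q, ω ∈ A → stoppedValue X τ ω = stoppedValue X σ ω := by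
  have hprog := isStronglyProgressive_of_rightContinuous hX hc
  have hmσ : Measurable (stoppedValue X σ) :=
    (measurable_stoppedValue hprog hσ).mono hσ.measurableSpace_le le_rfl
  refine ae_of_forall_localized hX hc hρ hσ hA (fun ω ↦ (hστ ω).trans (hC ω)) ?_
  intro B hB hBA k hB0 hBσ hBk
  have hBm : MeasurableSet B := hσ.measurableSpace_le B hB
  obtain ⟨Y, hYm, hY0, hYlim, hYX, hYint⟩ :=
    exists_localized_stoppedValue hc hX0 hρ hM hσ hτ hστ hC hB hB0 hBσ
  have hconst : ∀ c : ℝ, ∫⁻ ω in B, ENNReal.ofReal c ∂Q ≠ ⊤ := fun c ↦ by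
    simpa using ENNReal.mul_ne_top (by simp) (measure_ne_top _ _)
  -- The shift by `k` is needed because the localized values are known to lie on the path between
  -- `σ` and `τ` only from index `k` on.
  have hlim : Tendsto (fun n ↦ ∫⁻ ω in B, ENNReal.ofReal (Y (n + k) ω) ∂Q) atTop
      (𝓝 (∫⁻ ω in B, ENNReal.ofReal (stoppedValue X τ ω) ∂Q)) := by
    refine tendsto_lintegral_of_dominated_convergence' (fun _ ↦ ENNReal.ofReal (k + δ))
      (fun n ↦ (hYm _).ennreal_ofReal.restrict) (fun n ↦ ?_) (hconst _) ?_
    · rw [EventuallyLE, ae_restrict_iff' hBm]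
      filter_upwards [hYX, hδ] with ω h1 h2 hωB
      obtain ⟨t, hσt, htτ, hYt⟩ := h1 hωB (n + k) (Nat.le_add_left _ _)
      rw [hYt]
      refine ENNReal.ofReal_le_ofReal ((h2 (hBA hωB) t hσt htτ).trans ?_)
      have := hBk ω hωB
      linarith
    · rw [ae_restrict_iff' hBm]
      filter_upwards [hYlim] with ω hω hωB
      exact (ENNReal.continuous_ofReal.tendsto _).comp
        ((hω hωB).comp (tendsto_add_atTop_nat k))
  have hint : ∫⁻ ω in B, ENNReal.ofReal (stoppedValue X τ ω) ∂Q =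
      ∫⁻ ω in B, ENNReal.ofReal (stoppedValue X σ ω) ∂Q :=
    tendsto_nhds_unique hlim (tendsto_const_nhds.congr fun n ↦
      (hYint (n + k) (Nat.le_add_left _ _)).symm)
  have hfin : ∫⁻ ω in B, ENNReal.ofReal (stoppedValue X σ ω) ∂Q ≠ ⊤ :=
    ne_top_of_le_ne_top (hconst k)
      (setLIntegral_mono measurable_const fun ω hω ↦ ENNReal.ofReal_le_ofReal (hBk ω hω))
  have heq := ae_eq_of_ae_le_of_lintegral_le (μ := Q.restrict B)
    (f := fun ω ↦ ENNReal.ofReal (stoppedValue X τ ω))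
    (g := fun ω ↦ ENNReal.ofReal (stoppedValue X σ ω))
    (by
      rw [EventuallyLE, ae_restrict_iff' hBm]
      filter_upwards [hle] with ω hω hωB using ENNReal.ofReal_le_ofReal (hω (hBA hωB)))
    (hint ▸ hfin) hmσ.ennreal_ofReal.aemeasurable hint.ge
  rw [EventuallyEq, ae_restrict_iff' hBm] at heq
  filter_upwards [heq] with ω hω hωB
  exact (ENNReal.ofReal_eq_ofReal_iff (hX0 _ _) (hX0 _ _)).1 (hω hωB)

end Localization

/-! ### Condition (⋆) as an upper bound on paths -/

/-- Under condition `(⋆)`, a path that does not gain between `σ` and `τ` does not exceed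
`X_σ + δ` in between. -/
lemma ConditionStar.ae_le_add {P : Measure Ω} {𝓕 : Filtration ℝ≥0 m} {X : ℝ≥0 → Ω → ℝ}
    (hstar : ConditionStar 𝓕 X P) (h𝓕 : 𝓕.IsRightContinuous) (hX : StronglyAdapted 𝓕 X)
    (hc : ∀ ω t, ContinuousWithinAt (fun s ↦ X s ω) (Set.Ici t) t)
    {σ τ : Ω → WithTop ℝ≥0} (hσ : IsStoppingTime 𝓕 σ) (hτ : IsStoppingTime 𝓕 τ) (hστ : σ ≤ τ)
    {C : ℝ≥0} (hC : ∀ ω, τ ω ≤ C) {A : Set Ω} (hA : MeasurableSet[hσ.measurableSpace] A)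
    (hle : ∀ᵐ ω ∂P, ω ∈ A → stoppedValue X τ ω ≤ stoppedValue X σ ω) {δ : ℝ} (hδ : 0 < δ) :
    ∀ᵐ ω ∂P, ω ∈ A → ∀ t : ℝ≥0, σ ω ≤ t → t ≤ τ ω → X t ω ≤ stoppedValue X σ ω + δ := by
  have hσC : ∀ ω, σ ω ≤ C := fun ω ↦ (hστ ω).trans (hC ω)
  have hσC' : ∀ ω, (σ ω).untopA ≤ C := fun ω ↦ WithTop.untopA_le (hσC ω)
  set e : Ω → ℝ≥0 := fun ω ↦
    entryTime (fun s ↦ X s ω) (σ ω).untopA (stoppedValue X σ ω + δ) C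
  set ν : Ω → WithTop ℝ≥0 := fun ω ↦ (e ω : WithTop ℝ≥0)
  have hν : IsStoppingTime 𝓕 ν := isStoppingTime_entryTime h𝓕 hX hc hσ hσC δ
  have hνC : ∀ ω, ν ω ≤ C := fun ω ↦ WithTop.coe_le_coe.2 (entryTime_le (hσC' ω))
  have hσν : σ ≤ ν := fun ω ↦ by
    obtain ⟨s, hs⟩ := exists_eq_coe_of_le (hσC ω)
    have h1 : (σ ω).untopA ≤ e ω := le_entryTime (hσC' ω)
    rw [hs] at h1 ⊢
    exact WithTop.coe_le_coe.2 h1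
  -- On this event the price is at least `X_σ + δ` at `ν` and at most `X_σ` at `τ`, so it falls by
  -- `δ` between `ν` and `C`; were the event of positive probability, (⋆) at `ν` would be
  -- contradicted.
  have hzero : P (A ∩ {ω | ν ω < τ ω}) = 0 := by
    by_contra hne
    have hB : MeasurableSet[hν.measurableSpace] (A ∩ {ω | ν ω < τ ω}) := by
      refine (hσ.measurableSpace_mono hν hσν A hA).inter ?_
      have : {ω | ν ω < τ ω} = {ω | τ ω ≤ ν ω}ᶜ := by ext ω; simp
      rw [this]
      exact (hτ.measurableSet_stopping_time_le hν).compl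
    have hpos := hstar ν hν ⟨C, hνC⟩ _ hB (pos_iff_ne_zero.2 hne) δ hδ C (.of_forall hνC)
    refine hpos.ne' (measure_mono_null ?_ hle)
    rintro ω ⟨⟨hωA, hlt⟩, hinf⟩ hcon
    obtain ⟨t, ht⟩ := exists_eq_coe_of_le (hC ω)
    have hτle := hcon hωA
    have hlt' : ν ω < τ ω := hlt
    have htC : t ≤ C := WithTop.coe_le_coe.1 (ht ▸ hC ω)
    have het : e ω < t := WithTop.coe_lt_coe.1 (ht ▸ hlt')
    have h1 : stoppedValue X σ ω + δ ≤ X (e ω) ω :=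
      le_apply_entryTime (hc ω) (hσC' ω) (het.trans_le htC)
    have h2 : ((-δ : ℝ) : EReal) < ((X t ω - stoppedValue X ν ω : ℝ) : EReal) :=
      lt_of_lt_of_le hinf (iInf₂_le t ⟨WithTop.coe_le_coe.2 het.le, htC⟩)
    have h3 : -δ < X t ω - X (e ω) ω := EReal.coe_lt_coe_iff.1 h2
    have h4 : stoppedValue X τ ω = X t ω := by simp only [stoppedValue, ht]; rfl
    linarith
  have hzero' : ∀ᵐ ω ∂P, ω ∉ A ∩ {ω | ν ω < τ ω} := measure_eq_zero_iff_ae_notMem.1 hzero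
  filter_upwards [hzero', hle] with ω hω hωle hωA t hσt htτ
  have hτν : τ ω ≤ ν ω := not_lt.1 fun h ↦ hω ⟨hωA, h⟩
  rcases htτ.eq_or_lt with h | h
  · have h4 : stoppedValue X τ ω = X t ω := by simp only [stoppedValue, ← h]; rfl
    have := hωle hωA
    linarith
  · exact le_of_lt_entryTime (WithTop.untopA_le hσt) (WithTop.coe_lt_coe.1 (h.trans_le hτν))

/-! ### Reduction to a single interval -/

/-- Neither a long nor a short position held over a single stochastic interval, and entered on an
event known at the beginning of it, is an arbitrage. -/
def NoIntervalArbitrage (𝓕 : Filtration ℝ≥0 m) (X : ℝ≥0 → Ω → ℝ) (P : Measure Ω) : Prop :=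
  ∀ (σ τ : Ω → WithTop ℝ≥0) (hσ : IsStoppingTime 𝓕 σ), IsStoppingTime 𝓕 τ → σ ≤ τ →
    (∃ C : ℝ≥0, ∀ ω, τ ω ≤ C) → ∀ A : Set Ω, MeasurableSet[hσ.measurableSpace] A →
      ((∀ᵐ ω ∂P, ω ∈ A → stoppedValue X σ ω ≤ stoppedValue X τ ω) ∨
        ∀ᵐ ω ∂P, ω ∈ A → stoppedValue X τ ω ≤ stoppedValue X σ ω) →
      ∀ᵐ ω ∂P, ω ∈ A → stoppedValue X τ ω = stoppedValue X σ ω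

/-- Where the gain `G` before the last interval is negative, the last position must make up for it,
which is an arbitrage over that interval alone once its sign is fixed. Hence `G ≥ 0`, so `G = 0` by
induction, and then the last term is itself non-negative and vanishes for the same reason. -/
lemma ae_sum_eq_zero_of_noIntervalArbitrage {P : Measure Ω} {𝓕 : Filtration ℝ≥0 m}
    {X : ℝ≥0 → Ω → ℝ} (hprog : IsStronglyProgressive 𝓕 X) (hX : NoIntervalArbitrage 𝓕 X P)
    {τ : ℕ → Ω → WithTop ℝ≥0} (hτ : ∀ j, IsStoppingTime 𝓕 (τ j)) (hmono : Monotone τ)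
    (hbdd : ∀ j, ∃ C : ℝ≥0, ∀ ω, τ j ω ≤ C) {h : ℕ → Ω → ℝ}
    (hh : ∀ j, Measurable[(hτ j).measurableSpace] (h j)) (N : ℕ)
    (hpos : ∀ᵐ ω ∂P, 0 ≤ ∑ j ∈ Finset.range N,
      h j ω * (stoppedValue X (τ (j + 1)) ω - stoppedValue X (τ j) ω)) :
    ∀ᵐ ω ∂P, ∑ j ∈ Finset.range N,
      h j ω * (stoppedValue X (τ (j + 1)) ω - stoppedValue X (τ j) ω) = 0 := by
  induction N with
  | zero => simp
  | succ N ih =>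
    set G : Ω → ℝ := fun ω ↦ ∑ j ∈ Finset.range N,
      h j ω * (stoppedValue X (τ (j + 1)) ω - stoppedValue X (τ j) ω)
    have hG : Measurable[(hτ N).measurableSpace] G := by
      have hle : ∀ j ≤ N, (hτ j).measurableSpace ≤ (hτ N).measurableSpace := fun j hj ↦
        (hτ j).measurableSpace_mono (hτ N) (hmono hj)
      have hXj : ∀ j ≤ N, Measurable[(hτ N).measurableSpace] (stoppedValue X (τ j)) := fun j hj ↦
        (measurable_stoppedValue hprog (hτ j)).mono (hle j hj) le_rfl
      refine Finset.measurable_fun_sum _ fun j hj ↦ ?_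
      have hjN := Finset.mem_range.1 hj
      exact ((hh j).mono (hle j hjN.le) le_rfl).mul ((hXj (j + 1) hjN).sub (hXj j hjN.le))
    simp only [Finset.sum_range_succ] at hpos ⊢
    change ∀ᵐ ω ∂P, 0 ≤ G ω + _ at hpos
    change ∀ᵐ ω ∂P, G ω + _ = 0
    have key := hX (τ N) (τ (N + 1)) (hτ N) (hτ (N + 1)) (hmono N.le_succ) (hbdd (N + 1))
    have hGneg : MeasurableSet[(hτ N).measurableSpace] {ω | G ω < 0} :=
      measurableSet_lt hG measurable_const
    have hhpos : MeasurableSet[(hτ N).measurableSpace] {ω | 0 < h N ω} :=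
      measurableSet_lt measurable_const (hh N)
    have hhneg : MeasurableSet[(hτ N).measurableSpace] {ω | h N ω < 0} :=
      measurableSet_lt (hh N) measurable_const
    have h1 : ∀ᵐ ω ∂P, 0 ≤ G ω := by
      have k1 := key _ (hGneg.inter hhpos) <| Or.inl <| by
        filter_upwards [hpos] with ω hω ⟨hg, hp⟩
        simp only [Set.mem_ofPred_eq] at hg hp
        by_contra! hlt
        nlinarith
      have k2 := key _ (hGneg.inter hhneg) <| Or.inr <| by
        filter_upwards [hpos] with ω hω ⟨hg, hp⟩
        simp only [Set.mem_ofPred_eq] at hg hp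
        by_contra! hlt
        nlinarith
      filter_upwards [hpos, k1, k2] with ω hω hk1 hk2
      by_contra! hg
      rcases lt_trichotomy (h N ω) 0 with hp | hp | hp
      · rw [hk2 ⟨hg, hp⟩] at hω
        linarith
      · rw [hp] at hω
        linarith
      · rw [hk1 ⟨hg, hp⟩] at hω
        linarith
    have h2 : ∀ᵐ ω ∂P, G ω = 0 := ih h1
    have k1 := key _ hhpos <| Or.inl <| by
      filter_upwards [hpos, h2] with ω hω hg hp
      change 0 < h N ω at hp
      rw [hg] at hω
      by_contra! hlt
      nlinarith
    have k2 := key _ hhneg <| Or.inr <| by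
      filter_upwards [hpos, h2] with ω hω hg hp
      change h N ω < 0 at hp
      rw [hg] at hω
      by_contra! hlt
      nlinarith
    filter_upwards [h2, k1, k2] with ω hg hk1 hk2
    rw [hg]
    rcases lt_trichotomy (h N ω) 0 with hp | hp | hp
    · rw [hk2 hp]; ring
    · rw [hp]; ring
    · rw [hk1 hp]; ring

/-! ### Common refinement of the times of two strategies -/

/-- The increasing rearrangement of finitely many stopping times, continued by the largest one. -/
noncomputable def sortedTimes {n : ℕ} (θ : Fin (n + 1) → Ω → WithTop ℝ≥0) (j : ℕ) (ω : Ω) :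
    WithTop ℝ≥0 :=
  θ (Tuple.sort (fun i ↦ θ i ω) ⟨min j n, Nat.lt_succ_of_le (min_le_right _ _)⟩) ω

section sortedTimes

variable {n : ℕ} {θ : Fin (n + 1) → Ω → WithTop ℝ≥0}

lemma monotone_sortedTimes : Monotone (sortedTimes θ) := by
  intro i j hij ω
  exact Tuple.monotone_sort (fun i ↦ θ i ω) (Fin.mk_le_mk.2 (min_le_min_right n hij))

lemma exists_sortedTimes_eq (i : Fin (n + 1)) (ω : Ω) : ∃ p ≤ n, sortedTimes θ p ω = θ i ω := by
  refine ⟨(Tuple.sort (fun i ↦ θ i ω)).symm i, Nat.le_of_lt_succ (Fin.is_lt _), ?_⟩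
  unfold sortedTimes
  congr 1
  rw [← Equiv.eq_symm_apply]
  ext
  exact min_eq_left (Nat.le_of_lt_succ (Fin.is_lt _))

lemma sortedTimes_le {C : ℝ≥0} (hC : ∀ i ω, θ i ω ≤ C) (j : ℕ) (ω : Ω) :
    sortedTimes θ j ω ≤ C := hC _ _

/-- The time of rank `j` (counted from `0`) has occurred by `t` exactly when more than `j` of the
given times have, and this count is known at `t`. -/
lemma isStoppingTime_sortedTimes {𝓕 : Filtration ℝ≥0 m} (hθ : ∀ i, IsStoppingTime 𝓕 (θ i))
    (j : ℕ) : IsStoppingTime 𝓕 (sortedTimes θ j) := by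
  intro t
  have : {ω | sortedTimes θ j ω ≤ t} =
      {ω | min j n < ∑ i, if θ i ω ≤ t then 1 else 0} := by
    ext ω
    have := Tuple.lt_card_le_iff_apply_le_of_monotone (a := (t : WithTop ℝ≥0))
      (j := ⟨min j n, Nat.lt_succ_of_le (min_le_right _ _)⟩)
      (Tuple.monotone_sort (fun i ↦ θ i ω))
    simp only [Set.mem_ofPred_eq]
    rw [sortedTimes]
    refine this.symm.trans ?_
    rw [Finset.card_filter]
    simp only [Function.comp_apply]
    rw [Equiv.sum_comp (Tuple.sort (fun i ↦ θ i ω)) (fun i ↦ if θ i ω ≤ t then 1 else 0)]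
  rw [this]
  refine measurableSet_lt measurable_const (Finset.measurable_fun_sum _ fun i _ ↦ ?_)
  exact Measurable.ite (hθ i t) measurable_const measurable_const

end sortedTimes

/-- The sum telescopes. Activity is tested on the values `r p` and `r q`, not on the ranks `p` and
`q`: in the application the ranks depend on `ω` and times may coincide. -/
lemma sum_ite_mul_sub_eq {r : ℕ → WithTop ℝ≥0} (hr : Monotone r) {n p q : ℕ}
    (hq : q ≤ n) (hpq : r p ≤ r q) (c : ℝ) (x : WithTop ℝ≥0 → ℝ) :
    ∑ j ∈ Finset.range n, (if r p ≤ r j ∧ r j < r q then c else 0) * (x (r (j + 1)) - x (r j)) =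
      c * (x (r q) - x (r p)) := by
  -- The time `r j` is clamped to the range from `r p` to `r q`, so that increments outside it
  -- vanish.
  set φ : ℕ → ℝ := fun j ↦ c * x (max (r p) (min (r j) (r q)))
  have hterm : ∀ j, (if r p ≤ r j ∧ r j < r q then c else 0) * (x (r (j + 1)) - x (r j)) =
      φ (j + 1) - φ j := by
    intro j
    have hj : r j ≤ r (j + 1) := hr j.le_succ
    rcases lt_or_ge (r j) (r p) with h1 | h1
    · have h2 : r (j + 1) ≤ r p := hr (hr.reflect_lt h1)
      simp only [φ, not_le.2 h1, false_and, if_false, max_eq_left ((min_le_left _ _).trans h2),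
        max_eq_left ((min_le_left _ _).trans h1.le)]
      ring
    · rcases lt_or_ge (r j) (r q) with h2 | h2
      · have h3 : r (j + 1) ≤ r q := hr (hr.reflect_lt h2)
        simp only [φ, h1, h2, and_self, if_true, min_eq_left h3, min_eq_left h2.le,
          max_eq_right h1, max_eq_right (h1.trans hj)]
        ring
      · simp only [φ, not_lt.2 h2, and_false, if_false, min_eq_right h2,
          min_eq_right (h2.trans hj)]
        ring
  simp only [hterm, Finset.sum_range_sub]
  have hn : max (r p) (min (r n) (r q)) = r q := by
    rw [min_eq_right (hr hq), max_eq_right hpq]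
  have h0 : max (r p) (min (r 0) (r q)) = r p :=
    max_eq_left ((min_le_left _ _).trans (hr p.zero_le))
  simp only [φ, hn, h0]
  ring

/-- On `σ ≤ ρ`, an event of the past of `σ` belongs to the past of `min σ ρ`, hence to that of `ρ`.
-/
lemma measurable_indicator_le {𝓕 : Filtration ℝ≥0 m} {σ ρ : Ω → WithTop ℝ≥0}
    (hσ : IsStoppingTime 𝓕 σ) (hρ : IsStoppingTime 𝓕 ρ) {g : Ω → ℝ}
    (hg : Measurable[hσ.measurableSpace] g) :
    Measurable[hρ.measurableSpace] ({ω | σ ω ≤ ρ ω}.indicator g) := by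
  intro s hs
  have hle := hσ.measurableSet_stopping_time_le hρ
  rw [Set.indicator_preimage, Set.ite]
  refine MeasurableSet.union ?_ (MeasurableSet.diff ?_ hle)
  · exact ((hσ.measurableSet_min_iff hρ _).1 (hσ.measurableSet_inter_le hρ _ (hg hs))).2
  · exact (measurable_const (a := (0 : ℝ))) hs

/-- The position held over `(σ, τ]`, seen on an interval starting at `ρ`. -/
noncomputable def restartedPosition (σ τ ρ : Ω → WithTop ℝ≥0) (g : Ω → ℝ) (ω : Ω) : ℝ :=
  if σ ω ≤ ρ ω ∧ ρ ω < τ ω then g ω else 0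

lemma measurable_restartedPosition {𝓕 : Filtration ℝ≥0 m} {σ τ ρ : Ω → WithTop ℝ≥0}
    (hσ : IsStoppingTime 𝓕 σ) (hτ : IsStoppingTime 𝓕 τ) (hρ : IsStoppingTime 𝓕 ρ) {g : Ω → ℝ}
    (hg : Measurable[hσ.measurableSpace] g) :
    Measurable[hρ.measurableSpace] (restartedPosition σ τ ρ g) := by
  have hlt : MeasurableSet[hρ.measurableSpace] {ω | ρ ω < τ ω} := by
    have : {ω | ρ ω < τ ω} = {ω | τ ω ≤ ρ ω}ᶜ := by ext ω; simp
    rw [this]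
    exact (hτ.measurableSet_stopping_time_le hρ).compl
  convert (measurable_indicator_le hσ hρ hg).indicator hlt using 1
  ext ω
  by_cases h1 : σ ω ≤ ρ ω <;> by_cases h2 : ρ ω < τ ω <;>
    simp [restartedPosition, h1, h2]

lemma NoShortData.gain_eq_sum_sortedTimes {𝓕 : Filtration ℝ≥0 m} (V : NoShortData 𝓕)
    (X : ℝ≥0 → Ω → ℝ) {n : ℕ} {θ : Fin (n + 1) → Ω → WithTop ℝ≥0} {f : Fin (V.k + 1) → Fin (n + 1)}
    (hf : ∀ j, θ (f j) = V.τ j) (ω : Ω) :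
    V.gain X ω = ∑ l ∈ Finset.range n, (∑ j : Fin V.k,
        restartedPosition (V.τ j.castSucc) (V.τ j.succ) (sortedTimes θ l) (V.g j) ω) *
      (stoppedValue X (sortedTimes θ (l + 1)) ω - stoppedValue X (sortedTimes θ l) ω) := by
  simp only [Finset.sum_mul]
  rw [Finset.sum_comm]
  refine Finset.sum_congr rfl fun j _ ↦ ?_
  obtain ⟨p, -, hpe⟩ := exists_sortedTimes_eq (θ := θ) (f j.castSucc) ω
  obtain ⟨q, hq, hqe⟩ := exists_sortedTimes_eq (θ := θ) (f j.succ) ω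
  rw [hf] at hpe hqe
  have hpq : V.τ j.castSucc ω ≤ V.τ j.succ ω := V.mono ω (Fin.castSucc_lt_succ).le
  have := sum_ite_mul_sub_eq (p := p) (r := fun l ↦ sortedTimes θ l ω)
    (fun _ _ h ↦ monotone_sortedTimes h ω) hq (by simpa only [hpe, hqe] using hpq) (V.g j ω)
    (fun t ↦ X t.untopA ω)
  simp only [hpe, hqe] at this
  exact this.symm

lemma noArbitrage_of_noIntervalArbitrage {P : Measure Ω} {𝓕 : Filtration ℝ≥0 m}
    {X : ℝ≥0 → Ω → ℝ} (hprog : IsStronglyProgressive 𝓕 X) (hX : NoIntervalArbitrage 𝓕 X P) :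
    NoArbitrage 𝓕 X P := by
  rintro Z ⟨-, -, V, W, -, rfl⟩ hpos
  set θ : Fin ((V.k + 1 + W.k) + 1) → Ω → WithTop ℝ≥0 :=
    @Fin.append (V.k + 1) (W.k + 1) _ V.τ W.τ
  have hθ : ∀ i, IsStoppingTime 𝓕 (θ i) := by
    refine Fin.addCases (m := V.k + 1) (n := W.k + 1) (fun i ↦ ?_) (fun i ↦ ?_)
    · simpa only [θ, Fin.append_left] using V.stopping i
    · simpa only [θ, Fin.append_right] using W.stopping i
  have hbdd : ∀ i, ∃ C : ℝ≥0, ∀ ω, θ i ω ≤ C := by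
    refine Fin.addCases (m := V.k + 1) (n := W.k + 1) (fun i ↦ ?_) (fun i ↦ ?_)
    · simpa only [θ, Fin.append_left] using V.bounded i
    · simpa only [θ, Fin.append_right] using W.bounded i
  choose c hc using hbdd
  have hC : ∀ i ω, θ i ω ≤ ((∑ i, c i : ℝ≥0) : WithTop ℝ≥0) := fun i ω ↦
    (hc i ω).trans (WithTop.coe_le_coe.2
      (Finset.single_le_sum (fun _ _ ↦ zero_le) (Finset.mem_univ i)))
  have hst := isStoppingTime_sortedTimes hθ
  have hgain : ∀ ω, (V.gain X - W.gain X) ω = ∑ l ∈ Finset.range (V.k + 1 + W.k),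
      ((∑ j : Fin V.k,
        restartedPosition (V.τ j.castSucc) (V.τ j.succ) (sortedTimes θ l) (V.g j) ω) -
      ∑ j : Fin W.k,
        restartedPosition (W.τ j.castSucc) (W.τ j.succ) (sortedTimes θ l) (W.g j) ω) *
      (stoppedValue X (sortedTimes θ (l + 1)) ω - stoppedValue X (sortedTimes θ l) ω) := by
    intro ω
    rw [Pi.sub_apply, V.gain_eq_sum_sortedTimes X (θ := θ) (f := Fin.castAdd (W.k + 1))
        (fun j ↦ Fin.append_left _ _ j),
      W.gain_eq_sum_sortedTimes X (θ := θ) (f := Fin.natAdd (V.k + 1))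
        (fun j ↦ Fin.append_right _ _ j), ← Finset.sum_sub_distrib]
    exact Finset.sum_congr rfl fun l _ ↦ (sub_mul _ _ _).symm
  simp only [hgain] at hpos ⊢
  refine ae_sum_eq_zero_of_noIntervalArbitrage hprog hX hst monotone_sortedTimes
    (fun j ↦ ⟨_, sortedTimes_le hC j⟩) (h := fun l ω ↦ (∑ j : Fin V.k,
        restartedPosition (V.τ j.castSucc) (V.τ j.succ) (sortedTimes θ l) (V.g j) ω) -
      ∑ j : Fin W.k,
        restartedPosition (W.τ j.castSucc) (W.τ j.succ) (sortedTimes θ l) (W.g j) ω)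
    (fun l ↦ ?_) _ hpos
  exact (Finset.measurable_fun_sum _ fun j _ ↦ measurable_restartedPosition (V.stopping _)
      (V.stopping _) (hst l) (V.g_meas j)).sub
    (Finset.measurable_fun_sum _ fun j _ ↦ measurable_restartedPosition (W.stopping _)
      (W.stopping _) (hst l) (W.g_meas j))

/-! ### From no arbitrage to condition (⋆) -/

/-- The strategy `g 1_{(σ, τ]}`. -/
noncomputable def NoShortData.single {𝓕 : Filtration ℝ≥0 m} {σ τ : Ω → WithTop ℝ≥0}
    (hσ : IsStoppingTime 𝓕 σ) (hτ : IsStoppingTime 𝓕 τ) (hστ : σ ≤ τ) {C : ℝ≥0}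
    (hC : ∀ ω, τ ω ≤ C) {g : Ω → ℝ} (hg : Measurable[hσ.measurableSpace] g) (hg0 : ∀ ω, 0 ≤ g ω) :
    NoShortData 𝓕 where
  k := 1
  one_le_k := le_rfl
  τ := Fin.cases σ fun _ ↦ τ
  stopping := Fin.cases hσ fun _ ↦ hτ
  bounded := Fin.cases ⟨C, fun ω ↦ (hστ ω).trans (hC ω)⟩ fun _ ↦ ⟨C, hC⟩
  mono ω := by
    refine Fin.monotone_iff_le_succ.2 fun i ↦ ?_
    obtain rfl : i = 0 := Subsingleton.elim _ _
    exact hστ ω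
  g₀ := 0
  g₀_nonneg := le_rfl
  g _ := g
  g_meas j := by
    obtain rfl : j = 0 := Subsingleton.elim _ _
    exact hg
  g_nonneg _ := hg0

lemma NoShortData.single_gain {𝓕 : Filtration ℝ≥0 m} {σ τ : Ω → WithTop ℝ≥0}
    (hσ : IsStoppingTime 𝓕 σ) (hτ : IsStoppingTime 𝓕 τ) (hστ : σ ≤ τ) {C : ℝ≥0}
    (hC : ∀ ω, τ ω ≤ C) {g : Ω → ℝ} (hg : Measurable[hσ.measurableSpace] g) (hg0 : ∀ ω, 0 ≤ g ω)
    (X : ℝ≥0 → Ω → ℝ) (ω : Ω) :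
    (NoShortData.single hσ hτ hστ hC hg hg0).gain X ω =
      g ω * (stoppedValue X τ ω - stoppedValue X σ ω) :=
  Fin.sum_univ_one _

/-- If `(⋆)` fails then selling at `τ` on the exceptional event, and buying back once the price
has dropped by `ε / 2`, is an arbitrage. -/
lemma NoArbitrage.conditionStar {P : Measure Ω} {𝓕 : Filtration ℝ≥0 m} {X : ℝ≥0 → Ω → ℝ}
    (hNA : NoArbitrage 𝓕 X P) (h𝓕 : 𝓕.IsRightContinuous) (hX : StronglyAdapted 𝓕 X)
    (hc : ∀ ω t, ContinuousWithinAt (fun s ↦ X s ω) (Set.Ici t) t) :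
    ConditionStar 𝓕 X P := by
  rintro τ hτ ⟨C, hC⟩ A hA hPA ε hε T -
  refine pos_iff_ne_zero.2 fun hzero ↦ ?_
  -- The horizon lies strictly beyond `T`, so a drop by time `T` is a genuine entry and not an
  -- effect of the truncation.
  set K : ℝ≥0 := max C T + 1
  have hCK : C ≤ K := (le_max_left C T).trans le_self_add
  have hTK : T < K := (le_max_right C T).trans_lt (lt_add_of_pos_right _ one_pos)
  have hK : ∀ ω, τ ω ≤ K := fun ω ↦ (hC ω).trans (WithTop.coe_le_coe.2 hCK)
  have hK' : ∀ ω, (τ ω).untopA ≤ K := fun ω ↦ WithTop.untopA_le (hK ω)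
  have hc' : ∀ ω t, ContinuousWithinAt (fun s ↦ (-X) s ω) (Set.Ici t) t := fun ω t ↦ (hc ω t).neg
  set e : Ω → ℝ≥0 := fun ω ↦
    entryTime (fun s ↦ (-X) s ω) (τ ω).untopA (stoppedValue (-X) τ ω + ε / 2) K
  set ν : Ω → WithTop ℝ≥0 := fun ω ↦ (e ω : WithTop ℝ≥0)
  have hν : IsStoppingTime 𝓕 ν := isStoppingTime_entryTime h𝓕 hX.neg hc' hτ hK (ε / 2)
  have hνK : ∀ ω, ν ω ≤ K := fun ω ↦ WithTop.coe_le_coe.2 (entryTime_le (hK' ω))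
  have hτν : τ ≤ ν := fun ω ↦ by
    obtain ⟨s, hs⟩ := exists_eq_coe_of_le (hK ω)
    have h1 : (τ ω).untopA ≤ e ω := le_entryTime (hK' ω)
    rw [hs] at h1 ⊢
    exact WithTop.coe_le_coe.2 h1
  have hdrop : ∀ᵐ ω ∂P, ω ∈ A → stoppedValue X ν ω ≤ stoppedValue X τ ω - ε / 2 := by
    filter_upwards [measure_eq_zero_iff_ae_notMem.1 hzero] with ω hω hωA
    -- The infimum may equal `-ε` without being attained; with `ε / 2` a time of strict crossing
    -- exists.
    have hinf : (⨅ t ∈ {t : ℝ≥0 | τ ω ≤ t ∧ t ≤ T},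
        ((X t ω - stoppedValue X τ ω : ℝ) : EReal)) < ((-(ε / 2) : ℝ) : EReal) := by
      refine (not_lt.1 fun h ↦ hω ⟨hωA, h⟩).trans_lt (EReal.coe_lt_coe_iff.2 ?_)
      linarith
    obtain ⟨t, ht⟩ := iInf_lt_iff.1 hinf
    obtain ⟨⟨hτt, htT⟩, ht⟩ := iInf_lt_iff.1 ht
    have ht' : X t ω - stoppedValue X τ ω < -(ε / 2) := EReal.coe_lt_coe_iff.1 ht
    have hval : stoppedValue (-X) τ ω = -stoppedValue X τ ω := rfl
    have het : e ω ≤ t := by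
      by_contra! h
      have h2 : -X t ω ≤ stoppedValue (-X) τ ω + ε / 2 :=
        le_of_lt_entryTime (f := fun s ↦ (-X) s ω) (WithTop.untopA_le hτt) h
      rw [hval] at h2
      linarith
    have h1 : stoppedValue (-X) τ ω + ε / 2 ≤ -X (e ω) ω :=
      le_apply_entryTime (hc' ω) (hK' ω) (het.trans_lt (htT.trans_lt hTK))
    have h3 : stoppedValue X ν ω = X (e ω) ω := rfl
    rw [hval] at h1
    linarith
  have hg : Measurable[hτ.measurableSpace] (A.indicator fun _ ↦ (1 : ℝ)) :=
    measurable_const.indicator hA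
  set V := NoShortData.single hτ hν hτν hνK (g := fun _ ↦ 0) measurable_const fun _ ↦ le_rfl
  set W := NoShortData.single hτ hν hτν hνK hg
    fun ω ↦ Set.indicator_nonneg (fun _ _ ↦ zero_le_one) ω
  have hZ : ∀ ω, (V.gain X - W.gain X) ω =
      A.indicator (fun _ ↦ (1 : ℝ)) ω * (stoppedValue X τ ω - stoppedValue X ν ω) := by
    intro ω
    rw [Pi.sub_apply, NoShortData.single_gain, NoShortData.single_gain]
    ring
  have hmem : V.gain X - W.gain X ∈ outcomes 𝓕 X :=
    ⟨V.integrand - W.integrand, Set.sub_mem_sub ⟨V, rfl⟩ ⟨W, rfl⟩, V, W, rfl, rfl⟩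
  have h0 := hNA _ hmem <| by
    filter_upwards [hdrop] with ω hω
    rw [hZ]
    by_cases hωA : ω ∈ A
    · have := hω hωA
      rw [Set.indicator_of_mem hωA]
      linarith
    · simp [hωA]
  refine hPA.ne' (measure_eq_zero_iff_ae_notMem.2 ?_)
  filter_upwards [h0, hdrop] with ω h1 h2 hωA
  rw [hZ, Set.indicator_of_mem hωA] at h1
  have := h2 hωA
  linarith

/-! ### From condition (⋆) to no arbitrage -/

lemma ConditionStar.noIntervalArbitrage {P : Measure Ω} {𝓕 : Filtration ℝ≥0 m} {X : ℝ≥0 → Ω → ℝ}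
    (hstar : ConditionStar 𝓕 X P) (h𝓕 : 𝓕.IsRightContinuous) (hX : StronglyAdapted 𝓕 X)
    (hc : ∀ ω t, ContinuousWithinAt (fun s ↦ X s ω) (Set.Ici t) t) (hX0 : ∀ ω t, 0 ≤ X t ω)
    {Q : Measure Ω} [IsProbabilityMeasure Q] (hQP : Q ≪ P) (hPQ : P ≪ Q)
    (hloc : Locally (fun Y ↦ Martingale Y 𝓕 Q) 𝓕 X Q) :
    NoIntervalArbitrage 𝓕 X P := by
  obtain ⟨ρ, hρ, hM⟩ := hloc
  rintro σ τ hσ hτ hστ ⟨C, hC⟩ A hA (hle | hle)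
  · exact hPQ.ae_le (stoppedValue_eq_of_le_of_localMartingale hX hc hX0 hρ hM hσ hτ hστ hC hA
      (hQP.ae_le hle))
  · exact hPQ.ae_le (stoppedValue_eq_of_ge_of_localMartingale hX hc hX0 hρ hM hσ hτ hστ hC hA
      (hQP.ae_le hle)
      -- Any `δ > 0` would do, since the bound serves only for domination.
      (hQP.ae_le (hstar.ae_le_add h𝓕 hX hc hσ hτ hστ hC hA hle one_pos)))

/-! ### Passage to an indistinguishable process -/

section Indistinguishable

variable {P : Measure Ω} {𝓕 : Filtration ℝ≥0 m} {X Y : ℝ≥0 → Ω → ℝ}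

lemma NoArbitrage.congr (hXY : ∀ᵐ ω ∂P, ∀ t, X t ω = Y t ω) (h : NoArbitrage 𝓕 X P) :
    NoArbitrage 𝓕 Y P := by
  rintro Z ⟨H, hH, V, W, hVW, rfl⟩ hpos
  have hgain : ∀ᵐ ω ∂P, (V.gain Y - W.gain Y) ω = (V.gain X - W.gain X) ω := by
    filter_upwards [hXY] with ω hω
    simp only [Pi.sub_apply, NoShortData.gain, stoppedValue, hω]
  have h0 := h _ ⟨H, hH, V, W, hVW, rfl⟩ <| by
    filter_upwards [hgain, hpos] with ω h1 h2 using h1 ▸ h2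
  filter_upwards [hgain, h0] with ω h1 h2 using h1.trans h2

lemma ConditionStar.congr (hXY : ∀ᵐ ω ∂P, ∀ t, X t ω = Y t ω) (h : ConditionStar 𝓕 X P) :
    ConditionStar 𝓕 Y P := by
  intro τ hτ hC A hA hPA ε hε T hT
  refine (h τ hτ hC A hA hPA ε hε T hT).trans_le (measure_mono_ae ?_)
  filter_upwards [hXY] with ω hω ⟨h1, h2⟩
  refine ⟨h1, ?_⟩
  simpa only [Set.mem_ofPred_eq, stoppedValue, hω] using h2

/-- The same localizing sequence works: adaptedness survives because `N` is known at time `0`, the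
martingale property because `N` is null. -/
lemma locally_martingale_indicator_compl {N : Set Ω} (hN : MeasurableSet[𝓕 0] N) (hPN : P N = 0)
    (h : Locally (fun Y ↦ Martingale Y 𝓕 P) 𝓕 X P) :
    Locally (fun Y ↦ Martingale Y 𝓕 P) 𝓕 (fun t ↦ Nᶜ.indicator (X t)) P := by
  obtain ⟨ρ, hρ, hM⟩ := h
  refine ⟨ρ, hρ, fun n ↦ ?_⟩
  set M := stoppedProcess (fun i ↦ {ω | ⊥ < ρ n ω}.indicator (X i)) (ρ n)
  have heq : stoppedProcess (fun i ↦ {ω | ⊥ < ρ n ω}.indicator (Nᶜ.indicator (X i))) (ρ n) =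
      fun t ↦ Nᶜ.indicator (M t) := by
    ext t ω
    by_cases h1 : ω ∈ Nᶜ <;> by_cases h2 : ω ∈ {ω | ⊥ < ρ n ω} <;>
      simp only [stoppedProcess, M, Set.indicator_of_mem, Set.indicator_of_notMem, h1, h2,
        not_false_eq_true]
  have hae : ∀ t, Nᶜ.indicator (M t) =ᵐ[P] M t := fun t ↦
    (measure_eq_zero_iff_ae_notMem.1 hPN).mono fun ω hω ↦ Set.indicator_of_mem (s := Nᶜ) hω _
  rw [heq]
  refine ⟨fun t ↦ ((hM n).stronglyAdapted t).indicator (𝓕.mono zero_le _ hN).compl,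
    fun i j hij ↦ ?_⟩
  exact (condExp_congr_ae (hae j)).trans (((hM n).2 i j hij).trans (hae i).symm)

end Indistinguishable

end SimpleArbitrage

theorem proposition2p3 {Ω : Type*} {m : MeasurableSpace Ω} (P : Measure Ω) [IsProbabilityMeasure P]
    (𝓕 : Filtration ℝ≥0 m) (h𝓕 : SimpleArbitrage.UsualHypotheses 𝓕 P)
    (X : ℝ≥0 → Ω → ℝ)
    (hX_nonneg : ∀ᵐ ω ∂P, ∀ t, 0 ≤ X t ω)
    (hX_cadlag : SimpleArbitrage.IsCadlagProcess X P)
    (hX_semimartingale : SimpleArbitrage.IsSemimartingale X 𝓕 P)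
    (hX_elmm : SimpleArbitrage.AdmitsELMM X 𝓕 P) :
    SimpleArbitrage.NoArbitrage 𝓕 X P ↔ SimpleArbitrage.ConditionStar 𝓕 X P := by
  obtain ⟨Q, hQ, hQP, hPQ, hXQ⟩ := hX_elmm
  -- Setting `X` to zero on this null set makes every path non-negative and right continuous; the
  -- usual hypotheses place the set in `𝓕 0`, so the modification stays adapted.
  set N : Set Ω := toMeasurable P
    {ω | ¬ ((∀ t, 0 ≤ X t ω) ∧ SimpleArbitrage.IsCadlagPath (fun t ↦ X t ω))}
  have hPN : P N = 0 := by
    rw [measure_toMeasurable]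
    exact hX_nonneg.and hX_cadlag
  have hN : MeasurableSet[𝓕 0] N := h𝓕.null_mem N (measurableSet_toMeasurable _ _) hPN
  have hgood : ∀ ω ∉ N, (∀ t, 0 ≤ X t ω) ∧ SimpleArbitrage.IsCadlagPath (fun t ↦ X t ω) := by
    intro ω hω
    by_contra h
    exact hω (subset_toMeasurable P _ h)
  set Y : ℝ≥0 → Ω → ℝ := fun t ↦ Nᶜ.indicator (X t)
  have hXY : ∀ᵐ ω ∂P, ∀ t, X t ω = Y t ω := by
    filter_upwards [measure_eq_zero_iff_ae_notMem.1 hPN] with ω hω t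
    exact (Set.indicator_of_mem (s := Nᶜ) hω _).symm
  have hYX : ∀ᵐ ω ∂P, ∀ t, Y t ω = X t ω := hXY.mono fun ω h t ↦ (h t).symm
  have hY : StronglyAdapted 𝓕 Y := fun t ↦
    (hXQ.adapted t).indicator (𝓕.mono zero_le _ hN).compl
  have hY0 : ∀ ω t, 0 ≤ Y t ω := fun ω t ↦
    Set.indicator_apply_nonneg fun hω ↦ (hgood ω hω).1 t
  have hYc : ∀ ω t, ContinuousWithinAt (fun s ↦ Y s ω) (Set.Ici t) t := by
    intro ω t
    by_cases hω : ω ∈ Nᶜ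
    · simpa only [Y, Set.indicator_of_mem hω] using ((hgood ω hω).2 t).1
    · simpa only [Y, Set.indicator_of_notMem hω] using continuousWithinAt_const
  refine ⟨fun h ↦ ((h.congr hXY).conditionStar h𝓕.rightContinuous hY hYc).congr hYX, fun h ↦ ?_⟩
  refine SimpleArbitrage.NoArbitrage.congr hYX ?_
  exact SimpleArbitrage.noArbitrage_of_noIntervalArbitrage
    (SimpleArbitrage.isStronglyProgressive_of_rightContinuous hY hYc)
    ((h.congr hXY).noIntervalArbitrage h𝓕.rightContinuous hY hYc hY0 hQP hPQ
      (SimpleArbitrage.locally_martingale_indicator_compl hN (hQP hPN) hXQ.locally_martingale))
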